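/- Let $p\ge 5$ be an integer and write $c=p-4$, $d=p-3$, $x=p-2$. Define $m_0=1$, $m_1=p-2$, $m_{n+2}=(p-2)m_{n+1}-m_n$. A non-zero metallic code (nzm-code) of a positive integer $n$ is a word $a_k\ldots a_0$ of digits $a_i\in\{1,\ldots,x\}$ with $n=\sum_{i=0}^k a_i m_i$ in which no block $x\,d^{j}\,x$ ($j\ge 0$) occurs. Every positive integer $n$ has exactly one nzm-code, denoted by $[n]$; its last digit is called the signature of $n$. The successor of $\nu$ is the integer whose nzm-code is $[\nu]1$. The black metallic tree $\mathcal B$ is the infinite tree with black root in which each black node has $p-3$ sons and each white node has $p-2$ sons, exactly one son of each node being black; the nodes are numbered $1,2,3,\ldots$ level by level from left to right, starting from the root. An assignment $\alpha$ on $\mathcal B$ is a choice, for each node, of the position of the black son among its sons; it determines the status (black or white) of each node and the interval of integers formed by its sons (the $\alpha$-sons). The rightmost assignment $\rho$ makes the rightmost son of each node black, and $\mathcal B_\rho$ is $\mathcal B$ with this assignment. For a digit $a\in\{1,\ldots,x\}$, an assignment $\alpha$ has the preferred son property for $a$ if each node $\nu$ has exactly one $\alpha$-son whose nzm-code is $[\nu]a$.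 Theorem. 1. $\mathcal B_\rho$, each node being labelled by its status ($\mathbf b$ or $\mathbf w$) and its signature, is generated by the following rules, which give the labels of the sons of a node from left to right. The root: $\mathbf w2,\ldots,\mathbf wd,\mathbf bx$. Any other black node: $\mathbf w1,\ldots,\mathbf wc,\mathbf bd$. A white node of signature $a$ with $1<a<x$: $\mathbf w1,\ldots,\mathbf wd,\mathbf bx$. A white node of signature $1$ or $x$: $\mathbf wx,\mathbf w1,\ldots,\mathbf wc,\mathbf bd$. 2. The nzm-code of the $h$-th $\rho$-son of a node $\nu$ is as follows. If $\nu$ is the root: the one-digit word $h+1$ for $1\le h\le p-4$, and $x$ for $h=p-3$. If $\nu$ is another black node: $[\nu-1]h$ for $1\le h\le p-3$. If $\nu$ is a white node of signature $1$ or $x$: $[\nu-2]x$ for $h=1$, and $[\nu-1](h-1)$ for $2\le h\le p-2$. If $\nu$ is a white node of any other signature: $[\nu-1]h$ for $1\le h\le p-3$, and $[\nu-1]x$ for $h=p-2$. 3. The successor of each node $\nu$ is the leftmost or the second $\rho$-son of the node $\nu+1$. 4. The assignment $\rho$ does not have the preferred son property for any digit $a\in\{1,\ldots,x\}$. No assignment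 $\alpha$ on $\mathcal B$ has the preferred son property for any digit $a\in\{1,\ldots,x\}$; indeed, under no assignment does any node $\nu$ have a son whose nzm-code is $[\nu]a$. -/

import Mathlib

namespace MetallicTree

/-! Throughout, `p ≥ 5`.  The three largest digits are `c = p - 4`, `d = p - 3`, `x = p - 2`. -/

/-! ### Metallic numbers and non-zero metallic codes -/

/-- The metallic sequence: `m₀ = 1`, `m₁ = p - 2`, `m_{n+2} = (p - 2) m_{n+1} - m_n`. -/
def metallic (p : ℕ) : ℕ → ℤ
  | 0 => 1
  | 1 => (p : ℤ) - 2
  | n + 2 => ((p : ℤ) - 2) * metallic p (n + 1) - metallic p n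

/-- The number written by the word `a_k .. a_1 a_0` (a list, leftmost digit first):
`∑ i, a_i m_i`. -/
def value (p : ℕ) : List ℕ → ℤ
  | [] => 0
  | a :: w => (a : ℤ) * metallic p w.length + value p w

/-- The word contains the pattern `x d^k x` for some `k ≥ 0` as a block of consecutive digits. -/
def HasForbiddenPattern (p : ℕ) (w : List ℕ) : Prop :=
  ∃ k : ℕ, ([p - 2] ++ List.replicate k (p - 3) ++ [p - 2]) <:+: w

/-- `w` is a non-zero metallic code (nzm-code) of `n`. -/
structure IsNzmCode (p n : ℕ) (w : List ℕ) : Prop where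
  digits : ∀ a ∈ w, 1 ≤ a ∧ a ≤ p - 2
  allowed : ¬ HasForbiddenPattern p w
  value_eq : value p w = (n : ℤ)

/-- `[n]_nz`, the nzm-code of `n`. -/
noncomputable def nzmCode (p n : ℕ) : List ℕ :=
  Classical.epsilon (IsNzmCode p n)

/-- The nzm-signature of `n`: the rightmost digit of its nzm-code. -/
noncomputable def nzmSignature (p n : ℕ) : ℕ :=
  (nzmCode p n).getLastD 0

/-- `σ` is the successor of `ν`: the node whose nzm-code is `[ν]_nz 1`. -/
def IsSuccessor (p ν σ : ℕ) : Prop :=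
  1 ≤ σ ∧ nzmCode p σ = nzmCode p ν ++ [1]

/-! ### The black metallic tree and its assignments

Nodes are identified with their natural numbers: the root is `1`, and the nodes are numbered
level by level, from left to right, so that the sons of `ν + 1` (or, if `ν` is the last node of
its level, the sons of the first node of the next level) come just after the sons of `ν`. -/

/-- The literal status of a node. -/
inductive Status where
  | black
  | white

/-- The numerical status: `1` for black, `0` for white. -/
def Status.num : Status → ℕ
  | .black => 1
  | .white => 0

/-- A black node has `p - 3` sons, a white node has `p - 2` sons. -/
def sonCount (p : ℕ) (s : Status) : ℕ := p - 2 - s.num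

/-- An assignment `α` on the black metallic tree: for each node `ν`, its leftmost son
`first ν`, the position `pos ν` of its unique black son among its sons (the leftmost position
is `1`), and its status `stat ν`.  Only the values at positive integers matter. -/
structure Assignment (p : ℕ) where
  first : ℕ → ℕ
  pos : ℕ → ℕ
  stat : ℕ → Status
  stat_root : stat 1 = Status.black
  first_root : first 1 = 2
  first_succ : ∀ ν, 1 ≤ ν → first (ν + 1) = first ν + sonCount p (stat ν)
  pos_mem : ∀ ν, 1 ≤ ν → 1 ≤ pos ν ∧ pos ν ≤ sonCount p (stat ν)
  stat_son : ∀ ν, 1 ≤ ν → ∀ i, i < sonCount p (stat ν) →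
    (stat (first ν + i) = Status.black ↔ i + 1 = pos ν)

/-- The `α`-sons of `ν`, from left to right. -/
def Assignment.sons {p : ℕ} (α : Assignment p) (ν : ℕ) : List ℕ :=
  (List.range (sonCount p (α.stat ν))).map fun i => α.first ν + i

/-- The preferred son property for the digit `a`: each node `ν` has exactly one `α`-son whose
nzm-code is `[ν]_nz a`. -/
def Assignment.HasPreferredSons {p : ℕ} (α : Assignment p) (a : ℕ) : Prop :=
  ∀ ν, 1 ≤ ν → ∃! σ, σ ∈ α.sons ν ∧ nzmCode p σ = nzmCode p ν ++ [a]

/-! ### The rightmost assignment -/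

/-- The statuses of the sons of a node of status `s`, the black son being the rightmost one. -/
def rightmostRow (p : ℕ) (s : Status) : List Status :=
  List.replicate (sonCount p s - 1) Status.white ++ [Status.black]

/-- The statuses of the root and of the sons of the nodes `1, .., ν`, in the order of the
numbering. -/
def rightmostWord (p : ℕ) : ℕ → List Status
  | 0 => [Status.black]
  | ν + 1 => rightmostWord p ν ++
      rightmostRow p ((rightmostWord p ν).getD ν Status.white)

/-- The status of the node `n` under the rightmost assignment. -/
def rightmostStat (p n : ℕ) : Status :=
  (rightmostWord p (n - 1)).getD (n - 1) Status.white

theorem sonCount_pos {p : ℕ} (hp : 5 ≤ p) (s : Status) : 2 ≤ sonCount p s := by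
  cases s <;> simp [sonCount, Status.num] <;> omega

theorem length_rightmostRow {p : ℕ} (hp : 5 ≤ p) (s : Status) :
    (rightmostRow p s).length = sonCount p s := by
  have := sonCount_pos hp s
  simp [rightmostRow]
  omega

theorem lt_length_rightmostWord {p : ℕ} (hp : 5 ≤ p) (ν : ℕ) :
    ν < (rightmostWord p ν).length := by
  induction ν with
  | zero => simp [rightmostWord]
  | succ ν ih =>
    have h1 := length_rightmostRow hp ((rightmostWord p ν).getD ν Status.white)
    have h2 := sonCount_pos hp ((rightmostWord p ν).getD ν Status.white)
    rw [rightmostWord, List.length_append]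
    omega

theorem getD_rightmostWord {p : ℕ} {ν i : ℕ} (hi : i < (rightmostWord p ν).length) (k : ℕ) :
    (rightmostWord p (ν + k)).getD i Status.white = (rightmostWord p ν).getD i Status.white ∧
      i < (rightmostWord p (ν + k)).length := by
  induction k with
  | zero => exact ⟨rfl, hi⟩
  | succ k ih =>
    rw [← Nat.add_assoc, rightmostWord]
    refine ⟨?_, ?_⟩
    · rw [List.getD_append _ _ _ _ ih.2, ih.1]
    · rw [List.length_append]
      omega

theorem rightmostRow_eq_black {p : ℕ} (s : Status) (i : ℕ) (hi : i < sonCount p s) :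
    (rightmostRow p s).getD i Status.white = Status.black ↔ i + 1 = sonCount p s := by
  unfold rightmostRow
  rcases Nat.lt_or_ge i (sonCount p s - 1) with h | h
  · rw [List.getD_append _ _ _ _ (by simpa using h)]
    simp [h]
    omega
  · have h0 : i - (sonCount p s - 1) = 0 := by omega
    rw [List.getD_append_right _ _ _ _ (by simpa using h)]
    simp [h0]
    omega

/-- The rightmost assignment `ρ`: the black son of each node is its rightmost son. -/
def rightmost (p : ℕ) (hp : 5 ≤ p) : Assignment p where
  first ν := (rightmostWord p (ν - 1)).length + 1
  pos ν := sonCount p (rightmostStat p ν)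
  stat := rightmostStat p
  stat_root := rfl
  first_root := rfl
  first_succ := by
    intro ν hν
    obtain ⟨k, rfl⟩ : ∃ k, ν = k + 1 := ⟨ν - 1, by omega⟩
    simp only [Nat.add_sub_cancel, rightmostStat, rightmostWord, List.length_append,
      length_rightmostRow hp]
    omega
  pos_mem := by
    intro ν _
    have := sonCount_pos hp (rightmostStat p ν)
    omega
  stat_son := by
    intro ν hν i hi
    obtain ⟨k, rfl⟩ : ∃ k, ν = k + 1 := ⟨ν - 1, by omega⟩
    rw [← rightmostRow_eq_black _ i hi]
    have hk := lt_length_rightmostWord hp k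
    set L := (rightmostWord p k).length with hL
    have hlen : L + i < (rightmostWord p (k + 1)).length := by
      rw [rightmostWord, List.length_append, length_rightmostRow hp]
      simp only [rightmostStat, Nat.add_sub_cancel] at hi
      omega
    have h1 := (getD_rightmostWord hlen (L + i - (k + 1))).1
    have h2 : k + 1 + (L + i - (k + 1)) = L + i := by omega
    rw [h2] at h1
    have h3 : (rightmostWord p (k + 1)).getD (L + i) Status.white
        = (rightmostRow p (rightmostStat p (k + 1))).getD i Status.white := by
      rw [rightmostWord, List.getD_append_right _ _ _ _ (by omega), ← hL]
      simp [rightmostStat]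
    have h4 : rightmostStat p (L + 1 + i) = (rightmostWord p (L + i)).getD (L + i) Status.white := by
      have h5 : L + 1 + i - 1 = L + i := by omega
      simp only [rightmostStat, h5]
    simp only [Nat.add_sub_cancel]
    rw [h4, h1, h3]

/-! ### The rules and the table -/

/-- The kinds of nodes that the rules distinguish: the root `r`, the other black nodes `b` and
the white nodes `w`. -/
inductive Kind where
  | r
  | b
  | w

/-- The kind of the node `ν` under `α`. -/
def Assignment.kind {p : ℕ} (α : Assignment p) (ν : ℕ) : Kind :=
  if ν = 1 then Kind.r else
    match α.stat ν with
    | .black => Kind.b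
    | .white => Kind.w

/-- The white nodes with the consecutive signatures `i, .., j`. -/
def whites (i j : ℕ) : List (Status × ℕ) :=
  (List.range' i (j + 1 - i)).map fun a => (Status.white, a)

/-- The right-hand sides of the rules
`r1 → w2, .., wd, bx`,   `b → w1, .., wc, bd`,
`wa → w1, .., wd, bx` for `1 < a < x`,   `w1, wx → wx, w1, .., wc, bd`,
for a node of the given kind and of signature `a`. -/
def rules (p : ℕ) : Kind → ℕ → List (Status × ℕ)
  | .r, _ => whites 2 (p - 3) ++ [(Status.black, p - 2)]
  | .b, _ => whites 1 (p - 4) ++ [(Status.black, p - 3)]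
  | .w, a =>
    if a = 1 ∨ a = p - 2 then
      (Status.white, p - 2) :: whites 1 (p - 4) ++ [(Status.black, p - 3)]
    else whites 1 (p - 3) ++ [(Status.black, p - 2)]

/-- The table of the codes of the sons: the code of the `h`-th son of a node of the given kind
and of signature `a`, where `u` is the code of `ν - 1` and `v` is the code of `ν - 2`. -/
def table (p : ℕ) : Kind → ℕ → List ℕ → List ℕ → ℕ → List ℕ
  | .r, _, _, _, h => if h ≤ p - 4 then [h + 1] else [p - 2]
  | .b, _, u, _, h => u ++ [h]
  | .w, a, u, v, h =>
    if a = 1 ∨ a = p - 2 then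
      if h = 1 then v ++ [p - 2] else u ++ [h - 1]
    else
      if h ≤ p - 3 then u ++ [h] else u ++ [p - 2]

end MetallicTree

/-!
The codes themselves form a metallic tree with a white root: the codes `[n]a` are the sons of `n`
in the tree whose root is `0`, and they are the codes of the integers of the interval
`(S n, S (n + 1)]`, where `S n` is the number written `[n]0`. The black nodes of this tree are the
saturated words, those that end with `x d^j`, because they cannot be followed by `x`; they are
exactly the rightmost sons `S (k + 1)`.

The last `ρ`-son `F n` of `n` thus satisfies the same kind of recurrence as `S n`, with the black
nodes `F k` in place of the saturated nodes. By induction, for `n ≥ 1`, `F n` is `S n - 1` if `n`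
has the form `S (k + 1)` or `F (k + 1)`, and `S n` otherwise: the lag appears at the black node
`F (k + 1)` and lasts until the saturated node `S (k + 1)`, which is the same node or the next one.
Comparing the intervals of sons in both trees gives the rules, the table and the place of the
successor `S n + 1`.

For any assignment, the last son of `n` is determined by the number of black nodes among `1, .., n`;
this number exceeds that of the saturated nodes among `0, .., n - 1`, which puts the last son of `n`
at `S n` at most, to the left of all the codes `[n]a`.
-/

namespace MetallicTree

/-! ### Codes, with the last digit first -/

/-- The reversed word `r` begins with `d^k x` for some `k ≥ 0`: these are the words that cannot be
followed by the digit `x`. Words are reversed so that recursion on lists starts at the digit of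
weight `m₀`. -/
def Saturated (p : ℕ) (r : List ℕ) : Prop :=
  ∃ k, List.replicate k (p - 3) ++ [p - 2] <+: r

/-- The reversed word `r` is the reverse of an nzm-code. The pattern `x d^k x` is a palindrome, so
it may be sought in `r` itself. -/
def Admissible (p : ℕ) (r : List ℕ) : Prop :=
  (∀ a ∈ r, 1 ≤ a ∧ a ≤ p - 2) ∧ ¬ HasForbiddenPattern p r

/-- The number `∑ i, a_i μ_i` written by the reversed word `a_0 a_1 ..` with the weights `μ`. -/
def weightedSum (μ : ℕ → ℤ) : List ℕ → ℤ
  | [] => 0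
  | a :: r => a * μ 0 + weightedSum (fun i => μ (i + 1)) r

open Classical in
/-- The reversed code of the next integer: a last digit that can no longer grow is replaced by `1`,
with a carry. -/
noncomputable def increment (p : ℕ) : List ℕ → List ℕ
  | [] => [1]
  | a :: r => if Saturated p (a :: r) then 1 :: increment p r else (a + 1) :: r

/-- The reversed nzm-code of `n`. -/
noncomputable def revCode (p n : ℕ) : List ℕ := (increment p)^[n] []

open Classical in
/-- The number that the word `[n]0` would write: the integers with a code `[n]a` are those in the
interval from `shift p n + 1` to `shift p (n + 1)`. -/
noncomputable def shift (p : ℕ) : ℕ → ℕ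
  | 0 => 0
  | n + 1 => shift p n + if Saturated p (revCode p n) then p - 3 else p - 2

variable {p : ℕ}

theorem not_saturated_nil : ¬ Saturated p [] := by simp [Saturated]

theorem saturated_cons {a : ℕ} {r : List ℕ} :
    Saturated p (a :: r) ↔ a = p - 2 ∨ a = p - 3 ∧ Saturated p r := by
  constructor
  · rintro ⟨_ | k, hk⟩
    · exact Or.inl (by simpa [eq_comm] using hk)
    · rw [List.replicate_succ, List.cons_append, List.cons_prefix_cons] at hk
      exact Or.inr ⟨hk.1.symm, k, hk.2⟩
  · rintro (rfl | ⟨rfl, k, hk⟩)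
    · exact ⟨0, by simp⟩
    · exact ⟨k + 1, List.cons_prefix_cons.2 ⟨rfl, hk⟩⟩

theorem hasForbiddenPattern_cons {a : ℕ} {r : List ℕ} :
    HasForbiddenPattern p (a :: r) ↔ (a = p - 2 ∧ Saturated p r) ∨ HasForbiddenPattern p r := by
  simp only [HasForbiddenPattern, Saturated, List.infix_cons_iff, List.nil_append,
    List.cons_append, List.cons_prefix_cons, exists_or, exists_and_left, eq_comm (a := a)]

theorem hasForbiddenPattern_reverse {r : List ℕ} :
    HasForbiddenPattern p r.reverse ↔ HasForbiddenPattern p r :=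
  exists_congr fun k => by
    rw [← List.reverse_infix, List.reverse_reverse]
    simp

theorem admissible_nil : Admissible p [] := by simp [Admissible, HasForbiddenPattern]

theorem admissible_cons {a : ℕ} {r : List ℕ} :
    Admissible p (a :: r) ↔
      Admissible p r ∧ 1 ≤ a ∧ a ≤ p - 2 ∧ ¬ (a = p - 2 ∧ Saturated p r) := by
  rw [Admissible, Admissible, hasForbiddenPattern_cons, List.forall_mem_cons]
  tauto

theorem weightedSum_append_singleton (μ : ℕ → ℤ) (r : List ℕ) (b : ℕ) :
    weightedSum μ (r ++ [b]) = weightedSum μ r + b * μ r.length := by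
  induction r generalizing μ with
  | nil => simp [weightedSum]
  | cons a r ih =>
    rw [List.cons_append, weightedSum, ih, weightedSum, List.length_cons, add_assoc]

theorem weightedSum_metallic_reverse (w : List ℕ) :
    weightedSum (metallic p) w.reverse = value p w := by
  induction w with
  | nil => rfl
  | cons a w ih =>
    rw [List.reverse_cons, weightedSum_append_singleton, ih, value, List.length_reverse, add_comm]

theorem isNzmCode_iff {n : ℕ} {w : List ℕ} :
    IsNzmCode p n w ↔ Admissible p w.reverse ∧ weightedSum (metallic p) w.reverse = n := by
  rw [Admissible, hasForbiddenPattern_reverse, weightedSum_metallic_reverse]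
  simp only [List.mem_reverse]
  exact ⟨fun h => ⟨⟨h.digits, h.allowed⟩, h.value_eq⟩, fun h => ⟨h.1.1, h.1.2, h.2⟩⟩

theorem metallic_nonneg_and_le_succ (hp : 4 ≤ p) (n : ℕ) :
    0 ≤ metallic p n ∧ metallic p n ≤ metallic p (n + 1) := by
  induction n with
  | zero =>
    simp only [metallic]
    omega
  | succ n ih =>
    have hx : (2 : ℤ) ≤ p - 2 := by omega
    refine ⟨ih.1.trans ih.2, ?_⟩
    rw [metallic]
    linarith [mul_le_mul_of_nonneg_right hx (ih.1.trans ih.2)]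

theorem weightedSum_nonneg {μ : ℕ → ℤ} (hμ : ∀ i, 0 ≤ μ i) (r : List ℕ) :
    0 ≤ weightedSum μ r := by
  induction r generalizing μ with
  | nil => exact le_rfl
  | cons a r ih =>
    exact add_nonneg (mul_nonneg a.cast_nonneg (hμ 0)) (ih fun i => hμ (i + 1))

theorem Admissible.increment (hp : 4 ≤ p) {r : List ℕ} (hr : Admissible p r) :
    Admissible p (increment p r) := by
  induction r with
  | nil =>
    exact admissible_cons.2 ⟨hr, le_rfl, by omega, fun h => not_saturated_nil h.2⟩
  | cons a r ih =>
    obtain ⟨hr, ha, hax, -⟩ := admissible_cons.1 hr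
    rw [MetallicTree.increment]
    split_ifs with hsat
    · exact admissible_cons.2 ⟨ih hr, le_rfl, by omega, by omega⟩
    · rw [saturated_cons, not_or, not_and] at hsat
      exact admissible_cons.2 ⟨hr, by omega, by omega, fun h => hsat.2 (by omega) h.2⟩

open Classical in
/-- Replacing a last digit `x`, or a last digit `d` after a saturated word, by `1` with a carry
balances because of `μ₂ = x μ₁ - μ₀`. -/
theorem weightedSum_increment (hp : 3 ≤ p) {μ : ℕ → ℤ}
    (hμ : ∀ n, μ (n + 2) = ((p : ℤ) - 2) * μ (n + 1) - μ n) {r : List ℕ} (hr : Admissible p r) :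
    weightedSum (fun i => μ (i + 1)) (increment p r) =
      weightedSum (fun i => μ (i + 1)) r + μ 1 - if Saturated p r then μ 0 else 0 := by
  induction r generalizing μ with
  | nil => simp [increment, weightedSum, not_saturated_nil]
  | cons a r ih =>
    obtain ⟨hr, -, -, hax⟩ := admissible_cons.1 hr
    rw [increment]
    split_ifs with hsat
    · rw [weightedSum, ih (μ := fun i => μ (i + 1)) (fun n => hμ (n + 1)) hr, weightedSum, hμ 0]
      rcases saturated_cons.1 hsat with rfl | ⟨rfl, hs⟩
      · rw [if_neg fun hs => hax ⟨rfl, hs⟩, Nat.cast_sub (by omega)]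
        push_cast
        ring
      · rw [if_pos hs, Nat.cast_sub hp]
        push_cast
        ring
    · rw [weightedSum, weightedSum]
      push_cast
      ring

/-- The weights `0, m₀, m₁, ..` satisfy the metallic recurrence from the start. -/
theorem weightedSum_metallic_increment (hp : 3 ≤ p) {r : List ℕ} (hr : Admissible p r) :
    weightedSum (metallic p) (increment p r) = weightedSum (metallic p) r + 1 := by
  let μ : ℕ → ℤ := fun n => n.casesOn 0 (metallic p)
  have hμ : ∀ n, μ (n + 2) = ((p : ℤ) - 2) * μ (n + 1) - μ n := by
    rintro (_ | n)
    · change (p : ℤ) - 2 = (p - 2) * 1 - 0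
      ring
    · rfl
  have h := weightedSum_increment hp hμ hr
  rw [show μ 0 = 0 from rfl, show μ 1 = 1 from rfl, ite_self, sub_zero] at h
  exact h

theorem Admissible.exists_increment_eq (hp : 4 ≤ p) {r : List ℕ} (hr : Admissible p r)
    (hne : r ≠ []) : ∃ s, Admissible p s ∧ MetallicTree.increment p s = r := by
  induction r with
  | nil => exact absurd rfl hne
  | cons a r ih =>
    obtain ⟨htail, ha, hax, hsat⟩ := admissible_cons.1 hr
    rcases ha.eq_or_lt with rfl | ha
    · rcases eq_or_ne r [] with rfl | hnil
      · exact ⟨[], admissible_nil, rfl⟩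
      obtain ⟨s, hs, rfl⟩ := ih htail hnil
      by_cases hsat : Saturated p s
      · exact ⟨(p - 3) :: s, admissible_cons.2 ⟨hs, by omega, by omega, by omega⟩,
          if_pos (saturated_cons.2 (.inr ⟨rfl, hsat⟩))⟩
      · exact ⟨(p - 2) :: s, admissible_cons.2 ⟨hs, by omega, le_rfl, fun h => hsat h.2⟩,
          if_pos (saturated_cons.2 (.inl rfl))⟩
    · refine ⟨(a - 1) :: r, admissible_cons.2 ⟨htail, by omega, by omega, by omega⟩, ?_⟩
      rw [MetallicTree.increment, if_neg, Nat.sub_add_cancel ha.le]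
      rw [saturated_cons, not_or, not_and]
      exact ⟨by omega, fun _ h => hsat ⟨by omega, h⟩⟩

theorem revCode_zero : revCode p 0 = [] := rfl

theorem revCode_succ (n : ℕ) : revCode p (n + 1) = increment p (revCode p n) :=
  Function.iterate_succ_apply' _ _ _

theorem admissible_revCode (hp : 4 ≤ p) (n : ℕ) : Admissible p (revCode p n) := by
  induction n with
  | zero => exact admissible_nil
  | succ n ih =>
    rw [revCode_succ]
    exact ih.increment hp

theorem weightedSum_metallic_revCode (hp : 4 ≤ p) (n : ℕ) :
    weightedSum (metallic p) (revCode p n) = n := by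
  induction n with
  | zero => rfl
  | succ n ih =>
    rw [revCode_succ, weightedSum_metallic_increment (by omega) (admissible_revCode hp n), ih,
      Nat.cast_succ]

theorem Admissible.eq_revCode (hp : 4 ≤ p) {n : ℕ} {r : List ℕ} (hr : Admissible p r)
    (hn : weightedSum (metallic p) r = n) : r = revCode p n := by
  induction n generalizing r with
  | zero =>
    by_contra hne
    obtain ⟨s, hs, rfl⟩ := hr.exists_increment_eq hp hne
    have hs0 := weightedSum_nonneg (fun i => (metallic_nonneg_and_le_succ hp i).1) s
    rw [weightedSum_metallic_increment (by omega) hs] at hn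
    omega
  | succ n ih =>
    have hne : r ≠ [] := by
      rintro rfl
      rw [weightedSum] at hn
      omega
    obtain ⟨s, hs, rfl⟩ := hr.exists_increment_eq hp hne
    rw [weightedSum_metallic_increment (by omega) hs] at hn
    rw [revCode_succ, ih hs (by omega)]

theorem isNzmCode_iff_eq (hp : 4 ≤ p) {n : ℕ} {w : List ℕ} :
    IsNzmCode p n w ↔ w = (revCode p n).reverse := by
  rw [isNzmCode_iff]
  constructor
  · rintro ⟨hw, hn⟩
    rw [← hw.eq_revCode hp hn, List.reverse_reverse]
  · rintro rfl
    rw [List.reverse_reverse]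
    exact ⟨admissible_revCode hp n, weightedSum_metallic_revCode hp n⟩

theorem existsUnique_isNzmCode (hp : 4 ≤ p) (n : ℕ) : ∃! w, IsNzmCode p n w :=
  ⟨_, (isNzmCode_iff_eq hp).2 rfl, fun _ => (isNzmCode_iff_eq hp).1⟩

theorem nzmCode_eq_reverse (hp : 4 ≤ p) (n : ℕ) : nzmCode p n = (revCode p n).reverse :=
  (isNzmCode_iff_eq hp).1 (Classical.epsilon_spec (existsUnique_isNzmCode hp n).exists)

theorem nzmCode_zero (hp : 4 ≤ p) : nzmCode p 0 = [] := by
  rw [nzmCode_eq_reverse hp, revCode_zero, List.reverse_nil]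

theorem nzmCode_injective (hp : 4 ≤ p) : Function.Injective (nzmCode p) := by
  intro m n h
  rw [nzmCode_eq_reverse hp, nzmCode_eq_reverse hp, List.reverse_inj] at h
  have hm := weightedSum_metallic_revCode hp m
  rw [h, weightedSum_metallic_revCode hp n] at hm
  exact_mod_cast hm.symm

/-! ### The tree of codes -/

theorem shift_succ_of_saturated {n : ℕ} (h : Saturated p (revCode p n)) :
    shift p (n + 1) = shift p n + (p - 3) := by
  rw [shift, if_pos h]

theorem shift_succ_of_not_saturated {n : ℕ} (h : ¬ Saturated p (revCode p n)) :
    shift p (n + 1) = shift p n + (p - 2) := by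
  rw [shift, if_neg h]

theorem shift_one : shift p 1 = p - 2 := by
  rw [shift_succ_of_not_saturated not_saturated_nil, shift, zero_add]

theorem shift_add_le_shift_succ (n : ℕ) : shift p n + (p - 3) ≤ shift p (n + 1) := by
  rw [shift]
  split_ifs <;> omega

theorem shift_succ_le (n : ℕ) : shift p (n + 1) ≤ shift p n + (p - 2) := by
  rw [shift]
  split_ifs <;> omega

theorem strictMono_shift (hp : 4 ≤ p) : StrictMono (shift p) :=
  strictMono_nat_of_lt_succ fun n => by
    have := shift_add_le_shift_succ (p := p) n
    omega

theorem shift_add_le_shift (hp : 4 ≤ p) {m n : ℕ} (h : m < n) :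
    shift p m + (p - 3) ≤ shift p n :=
  (shift_add_le_shift_succ m).trans ((strictMono_shift hp).monotone h)

theorem exists_shift_lt_le_shift_succ (hp : 4 ≤ p) {m : ℕ} (hm : 1 ≤ m) :
    ∃ n, shift p n < m ∧ m ≤ shift p (n + 1) :=
  (strictMono_shift hp).exists_between_of_tendsto_atTop (strictMono_shift hp).tendsto_atTop hm

/-- A last digit `a` after `[n]` can grow until the word is saturated, which happens at the value
`shift p (n + 1)`; the carry then leads to `[n + 1]1`. -/
theorem saturated_cons_sub_iff {m n : ℕ} (hp : 3 ≤ p) (hn : shift p n < m)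
    (hm : m ≤ shift p (n + 1)) :
    Saturated p ((m - shift p n) :: revCode p n) ↔ m = shift p (n + 1) := by
  rw [saturated_cons]
  by_cases hs : Saturated p (revCode p n)
  · rw [shift_succ_of_saturated hs] at hm ⊢
    simp only [hs, and_true]
    omega
  · rw [shift_succ_of_not_saturated hs] at hm ⊢
    simp only [hs, and_false, or_false]
    omega

theorem revCode_eq_cons (hp : 4 ≤ p) {m n : ℕ} (hn : shift p n < m)
    (hm : m ≤ shift p (n + 1)) : revCode p m = (m - shift p n) :: revCode p n := by
  induction m generalizing n with
  | zero => omega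
  | succ m ih =>
    rw [revCode_succ]
    obtain hmn | hmn : shift p n < m ∨ shift p n = m := by omega
    · rw [ih hmn (by omega), increment,
        if_neg fun h => by have := (saturated_cons_sub_iff (by omega) hmn (by omega)).1 h; omega,
        Nat.sub_add_comm hmn.le]
    · subst hmn
      rcases n with _ | n
      · rfl
      · have hlt := strictMono_shift hp n.lt_add_one
        rw [ih hlt le_rfl, increment,
          if_pos ((saturated_cons_sub_iff (by omega) hlt le_rfl).2 rfl), ← revCode_succ,
          Nat.add_sub_cancel_left]

theorem saturated_revCode_iff (hp : 4 ≤ p) {m : ℕ} :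
    Saturated p (revCode p m) ↔ ∃ n, shift p (n + 1) = m := by
  constructor
  · intro hs
    have hm : 1 ≤ m := Nat.pos_of_ne_zero (by rintro rfl; exact not_saturated_nil hs)
    obtain ⟨n, hn, hle⟩ := exists_shift_lt_le_shift_succ hp hm
    rw [revCode_eq_cons hp hn hle, saturated_cons_sub_iff (by omega) hn hle] at hs
    exact ⟨n, hs.symm⟩
  · rintro ⟨n, rfl⟩
    have hn := strictMono_shift hp n.lt_add_one
    rw [revCode_eq_cons hp hn le_rfl]
    exact (saturated_cons_sub_iff (by omega) hn le_rfl).2 rfl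

theorem nzmCode_eq_append (hp : 4 ≤ p) {m n : ℕ} (hn : shift p n < m)
    (hm : m ≤ shift p (n + 1)) : nzmCode p m = nzmCode p n ++ [m - shift p n] := by
  rw [nzmCode_eq_reverse hp, nzmCode_eq_reverse hp, revCode_eq_cons hp hn hm, List.reverse_cons]

theorem nzmSignature_eq_sub (hp : 4 ≤ p) {m n : ℕ} (hn : shift p n < m)
    (hm : m ≤ shift p (n + 1)) : nzmSignature p m = m - shift p n := by
  rw [nzmSignature, nzmCode_eq_append hp hn hm, List.getLastD_concat]

theorem nzmCode_eq_append_iff (hp : 4 ≤ p) {m n a : ℕ} :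
    nzmCode p m = nzmCode p n ++ [a] ↔
      shift p n < m ∧ m ≤ shift p (n + 1) ∧ a = m - shift p n := by
  constructor
  · intro h
    have hm : 1 ≤ m := Nat.pos_of_ne_zero (by rintro rfl; simp [nzmCode_zero hp] at h)
    obtain ⟨k, hk, hle⟩ := exists_shift_lt_le_shift_succ hp hm
    rw [nzmCode_eq_append hp hk hle, List.append_singleton_inj, (nzmCode_injective hp).eq_iff] at h
    obtain ⟨rfl, rfl⟩ := h
    exact ⟨hk, hle, rfl⟩
  · rintro ⟨hn, hm, rfl⟩
    exact nzmCode_eq_append hp hn hm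

theorem nzmSignature_succ_eq_one_iff (hp : 4 ≤ p) {n : ℕ} (hn : 1 ≤ n) :
    nzmSignature p (n + 1) = 1 ↔ Saturated p (revCode p n) := by
  rw [saturated_revCode_iff hp]
  constructor
  · intro h
    obtain ⟨k, hk, hle⟩ := exists_shift_lt_le_shift_succ (m := n + 1) hp (by omega)
    rw [nzmSignature_eq_sub hp hk hle] at h
    rcases k with _ | k
    · rw [shift] at h
      omega
    · exact ⟨k, by omega⟩
  · rintro ⟨k, rfl⟩
    have hgap := shift_add_le_shift_succ (p := p) (k + 1)
    rw [nzmSignature_eq_sub hp (Nat.lt_add_one _) (by omega), Nat.add_sub_cancel_left]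

theorem isSuccessor_iff (hp : 4 ≤ p) {ν σ : ℕ} : IsSuccessor p ν σ ↔ σ = shift p ν + 1 := by
  have hlt := strictMono_shift hp ν.lt_add_one
  rw [IsSuccessor, nzmCode_eq_append_iff hp]
  omega

/-! ### Assignments -/

theorem sonCount_black : sonCount p .black = p - 3 := by
  simp only [sonCount, Status.num, Nat.sub_sub]

theorem sonCount_white : sonCount p .white = p - 2 := rfl

namespace Assignment

variable (α : Assignment p)

/-- The rightmost `α`-son of `n`. The value at `0` is `1`: the root plays the part of the rightmost
son of a virtual node `0`, so that the sons of `n + 1` are the integers from `lastSon n + 1` to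
`lastSon (n + 1)`. -/
def lastSon (n : ℕ) : ℕ := α.first (n + 1) - 1

theorem first_eq_lastSon_add_one (n : ℕ) : α.first (n + 1) = α.lastSon n + 1 := by
  have hpos : 1 ≤ α.first (n + 1) := by
    induction n with
    | zero => simp [α.first_root]
    | succ n ih =>
      rw [α.first_succ (n + 1) (by omega)]
      omega
  exact (Nat.sub_add_cancel hpos).symm

theorem lastSon_zero : α.lastSon 0 = 1 := by simp [lastSon, α.first_root]

theorem lastSon_succ (n : ℕ) :
    α.lastSon (n + 1) = α.lastSon n + sonCount p (α.stat (n + 1)) := by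
  have h := α.first_succ (n + 1) (by omega)
  rw [first_eq_lastSon_add_one, first_eq_lastSon_add_one] at h
  omega

theorem lastSon_succ_of_black {n : ℕ} (h : α.stat (n + 1) = .black) :
    α.lastSon (n + 1) = α.lastSon n + (p - 3) := by
  rw [lastSon_succ, h, sonCount_black]

theorem lastSon_succ_of_white {n : ℕ} (h : α.stat (n + 1) = .white) :
    α.lastSon (n + 1) = α.lastSon n + (p - 2) := by
  rw [lastSon_succ, h, sonCount_white]

theorem lastSon_one (hp : 3 ≤ p) : α.lastSon 1 = p - 2 := by
  rw [α.lastSon_succ_of_black α.stat_root, lastSon_zero]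
  omega

theorem lastSon_add_le_lastSon_succ (n : ℕ) :
    α.lastSon n + (p - 3) ≤ α.lastSon (n + 1) := by
  cases h : α.stat (n + 1) with
  | black => rw [α.lastSon_succ_of_black h]
  | white =>
    rw [α.lastSon_succ_of_white h]
    omega

theorem strictMono_lastSon (hp : 4 ≤ p) : StrictMono α.lastSon :=
  strictMono_nat_of_lt_succ fun n => by
    have := α.lastSon_add_le_lastSon_succ n
    omega

theorem lastSon_add_le_lastSon (hp : 4 ≤ p) {m n : ℕ} (h : m < n) :
    α.lastSon m + (p - 3) ≤ α.lastSon n :=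
  (α.lastSon_add_le_lastSon_succ m).trans ((α.strictMono_lastSon hp).monotone h)

theorem exists_lastSon_lt_le_lastSon_succ (hp : 4 ≤ p) {m : ℕ} (hm : 1 < m) :
    ∃ n, α.lastSon n < m ∧ m ≤ α.lastSon (n + 1) :=
  (α.strictMono_lastSon hp).exists_between_of_tendsto_atTop
    (α.strictMono_lastSon hp).tendsto_atTop (by rwa [lastSon_zero])

theorem sons_eq_range' (n : ℕ) :
    α.sons (n + 1) = List.range' (α.lastSon n + 1) (sonCount p (α.stat (n + 1))) := by
  rw [sons, first_eq_lastSon_add_one, List.range'_eq_map_range]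

theorem mem_sons_iff {n σ : ℕ} :
    σ ∈ α.sons (n + 1) ↔ α.lastSon n < σ ∧ σ ≤ α.lastSon (n + 1) := by
  rw [sons_eq_range', List.mem_range'_1, lastSon_succ]
  omega

theorem getElem?_sons {n h : ℕ} (h1 : 1 ≤ h) (hle : h ≤ sonCount p (α.stat (n + 1))) :
    (α.sons (n + 1))[h - 1]? = some (α.lastSon n + h) := by
  rw [sons_eq_range', List.getElem?_range' (by omega), one_mul, add_assoc, Nat.add_sub_cancel' h1]

theorem exists_black_son (n : ℕ) :
    ∃ b, α.lastSon n < b ∧ b ≤ α.lastSon (n + 1) ∧ α.stat b = .black := by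
  have hpos := α.pos_mem (n + 1) (by omega)
  have hson := α.stat_son (n + 1) (by omega) (α.pos (n + 1) - 1) (by omega)
  rw [first_eq_lastSon_add_one] at hson
  have hlast := α.lastSon_succ n
  exact ⟨_, by omega, by omega, hson.2 (by omega)⟩

theorem lastSon_add_le (m j : ℕ) : α.lastSon (m + j) ≤ α.lastSon m + j * (p - 2) := by
  induction j with
  | zero => simp
  | succ j ih =>
    have hcount : sonCount p (α.stat (m + j + 1)) ≤ p - 2 := Nat.sub_le _ _
    rw [← add_assoc, lastSon_succ, Nat.add_mul]
    omega

/-- The sons of the nodes `1, .., n` would be `n (p - 2)` in number if all these nodes were white,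
and the root and each of the `k` complete families among them bring one black node. -/
theorem lastSon_add_le_mul (hp : 4 ≤ p) {k n : ℕ} (h : α.lastSon k ≤ n) :
    α.lastSon n + k ≤ n * (p - 2) := by
  induction k generalizing n with
  | zero =>
    rw [lastSon_zero] at h
    obtain ⟨j, rfl⟩ := Nat.exists_eq_add_of_le h
    have hle := α.lastSon_add_le 1 j
    rw [α.lastSon_one (by omega)] at hle
    rwa [Nat.add_mul, one_mul]
  | succ k ih =>
    obtain ⟨b, hkb, hb, hblack⟩ := α.exists_black_son k
    obtain ⟨b, rfl⟩ : ∃ b', b = b' + 1 := ⟨b - 1, by omega⟩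
    obtain ⟨j, rfl⟩ := Nat.exists_eq_add_of_le (hb.trans h)
    have hle := α.lastSon_add_le (b + 1) j
    have ihb := ih (show α.lastSon k ≤ b by omega)
    rw [α.lastSon_succ_of_black hblack] at hle
    rw [Nat.add_mul, Nat.add_mul, one_mul]
    omega

end Assignment

theorem mul_le_shift_add (hp : 4 ≤ p) {k n : ℕ} (h : n ≤ shift p (k + 1)) :
    n * (p - 2) ≤ shift p n + k := by
  induction n generalizing k with
  | zero => simp
  | succ n ih =>
    rw [Nat.add_mul, one_mul]
    by_cases hs : Saturated p (revCode p n)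
    · rw [shift_succ_of_saturated hs]
      obtain ⟨j, rfl⟩ := (saturated_revCode_iff hp).1 hs
      have hjk : j + 1 < k + 1 := (strictMono_shift hp).lt_iff_lt.1 h
      have := ih le_rfl
      omega
    · rw [shift_succ_of_not_saturated hs]
      have := ih (show n ≤ shift p (k + 1) by omega)
      omega

theorem Assignment.lastSon_le_shift (hp : 4 ≤ p) (α : Assignment p) {n : ℕ} (hn : 1 ≤ n) :
    α.lastSon n ≤ shift p n := by
  induction n using Nat.strong_induction_on with
  | _ n ih =>
  obtain ⟨k, hk, hnk⟩ := exists_shift_lt_le_shift_succ hp hn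
  have hlast : α.lastSon k ≤ n := by
    rcases Nat.eq_zero_or_pos k with rfl | hk0
    · rwa [α.lastSon_zero]
    · have := ih k (((strictMono_shift hp).le_apply).trans_lt hk) hk0
      omega
  have hα := α.lastSon_add_le_mul hp hlast
  have hshift := mul_le_shift_add hp hnk
  omega

theorem nzmCode_ne_of_mem_sons (hp : 4 ≤ p) (α : Assignment p) {ν σ : ℕ} (hν : 1 ≤ ν) (a : ℕ)
    (hσ : σ ∈ α.sons ν) : nzmCode p σ ≠ nzmCode p ν ++ [a] := by
  intro h
  obtain ⟨n, rfl⟩ := Nat.exists_eq_add_of_le' hν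
  have hlt := ((nzmCode_eq_append_iff hp).1 h).1
  have hle := (α.mem_sons_iff.1 hσ).2.trans (α.lastSon_le_shift hp hν)
  omega

theorem not_hasPreferredSons (hp : 4 ≤ p) (α : Assignment p) (a : ℕ) :
    ¬ α.HasPreferredSons a := by
  intro h
  obtain ⟨σ, ⟨hσ, hcode⟩, -⟩ := h 1 le_rfl
  exact nzmCode_ne_of_mem_sons hp α le_rfl a hσ hcode

/-! ### The rightmost assignment -/

theorem stat_rightmost_eq_black_iff (hp : 5 ≤ p) {m : ℕ} (hm : 1 ≤ m) :
    (rightmost p hp).stat m = .black ↔ ∃ k, (rightmost p hp).lastSon k = m := by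
  have hmono := (rightmost p hp).strictMono_lastSon (by omega)
  rcases hm.eq_or_lt with rfl | hm
  · exact iff_of_true (rightmost p hp).stat_root ⟨0, (rightmost p hp).lastSon_zero⟩
  obtain ⟨n, hn, hle⟩ := (rightmost p hp).exists_lastSon_lt_le_lastSon_succ (by omega) hm
  have hsucc := (rightmost p hp).lastSon_succ n
  have hson := (rightmost p hp).stat_son (n + 1) (by omega)
    (m - ((rightmost p hp).lastSon n + 1)) (by omega)
  rw [Assignment.first_eq_lastSon_add_one, Nat.add_sub_cancel' hn] at hson
  rw [hson]
  change _ = sonCount p ((rightmost p hp).stat (n + 1)) ↔ _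
  constructor
  · intro h
    exact ⟨n + 1, by omega⟩
  · rintro ⟨k, rfl⟩
    have hnk := hmono.lt_iff_lt.1 hn
    have hkn := hmono.le_iff_le.1 hle
    obtain rfl : k = n + 1 := by omega
    omega

theorem stat_rightmost_eq_white_iff (hp : 5 ≤ p) {m : ℕ} (hm : 1 ≤ m) :
    (rightmost p hp).stat m = .white ↔ ∀ k, (rightmost p hp).lastSon k ≠ m := by
  rw [← not_exists, ← stat_rightmost_eq_black_iff hp hm]
  cases (rightmost p hp).stat m <;> simp

/-- The node `n` is the last one of a family of brothers, either in the tree of codes or, the root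
excepted, in the rightmost tree. For `n ≥ 1`, the last son of `n` in the rightmost tree is
`shift p n - 1` for these nodes and `shift p n` for the others. -/
def EndsFamily (p : ℕ) (hp : 5 ≤ p) (n : ℕ) : Prop :=
  Saturated p (revCode p n) ∨ ∃ k, (rightmost p hp).lastSon (k + 1) = n

theorem not_endsFamily_one (hp : 5 ≤ p) : ¬ EndsFamily p hp 1 := by
  rw [EndsFamily, saturated_revCode_iff (by omega)]
  rintro (⟨k, hk⟩ | ⟨k, hk⟩)
  · have := (strictMono_shift (p := p) (by omega)).monotone (Nat.le_add_left 1 k)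
    rw [shift_one] at this
    omega
  · have := ((rightmost p hp).strictMono_lastSon (by omega)).monotone (Nat.le_add_left 1 k)
    rw [Assignment.lastSon_one _ (by omega)] at this
    omega

theorem stat_rightmost_eq_black_iff_exists_succ (hp : 5 ≤ p) {m : ℕ} (hm : 1 < m) :
    (rightmost p hp).stat m = .black ↔ ∃ k, (rightmost p hp).lastSon (k + 1) = m := by
  rw [stat_rightmost_eq_black_iff hp hm.le]
  constructor
  · rintro ⟨_ | k, hk⟩
    · rw [Assignment.lastSon_zero] at hk
      omega
    · exact ⟨k, hk⟩
  · rintro ⟨k, hk⟩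
    exact ⟨k + 1, hk⟩

/-- The relation between the last sons of `n` in the rightmost tree and in the tree of codes. It
holds for `n ≥ 1`, and is named because its proof by induction uses it at several smaller nodes. -/
def LastSonFormula (p : ℕ) (hp : 5 ≤ p) (n : ℕ) : Prop :=
  EndsFamily p hp n ∧ (rightmost p hp).lastSon n + 1 = shift p n ∨
    ¬ EndsFamily p hp n ∧ (rightmost p hp).lastSon n = shift p n

theorem LastSonFormula.of_endsFamily {hp : 5 ≤ p} {n : ℕ} (h : LastSonFormula p hp n)
    (hend : EndsFamily p hp n) : (rightmost p hp).lastSon n + 1 = shift p n :=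
  h.elim And.right fun h' => absurd hend h'.1

theorem LastSonFormula.of_not_endsFamily {hp : 5 ≤ p} {n : ℕ} (h : LastSonFormula p hp n)
    (hend : ¬ EndsFamily p hp n) : (rightmost p hp).lastSon n = shift p n :=
  h.elim (fun h' => absurd h'.1 hend) And.right

theorem not_endsFamily_succ_of_saturated (hp : 5 ≤ p) {n : ℕ}
    (hF : ∀ m ≤ n, 1 ≤ m → LastSonFormula p hp m) (hs : Saturated p (revCode p n)) :
    ¬ EndsFamily p hp (n + 1) := by
  induction n using Nat.strong_induction_on with
  | _ n ih =>
  have hS := strictMono_shift (p := p) (by omega)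
  obtain ⟨j, rfl⟩ := (saturated_revCode_iff (by omega)).1 hs
  rintro (hs' | ⟨k, hk⟩)
  · obtain ⟨i, hi⟩ := (saturated_revCode_iff (by omega)).1 hs'
    have := shift_add_le_shift (p := p) (by omega)
      (hS.lt_iff_lt.1 (show shift p (j + 1) < shift p (i + 1) by omega))
    omega
  have hkn : k + 1 ≤ shift p (j + 1) := by
    have := ((rightmost p hp).strictMono_lastSon (by omega)).le_apply (x := k)
    have := (rightmost p hp).lastSon_add_le_lastSon_succ k
    omega
  have hformula := hF (k + 1) hkn (by omega)
  have hjk : j + 1 < k + 1 := hS.lt_iff_lt.1 (by rcases hformula with h | h <;> omega)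
  have hgap := shift_add_le_shift (p := p) (by omega) hjk
  have hend : EndsFamily p hp (k + 1) := by
    rcases hformula with h | h
    · exact h.1
    · omega
  have hshift := hformula.of_endsFamily hend
  -- Here `S (k + 1) = S (j + 1) + 2`, and a node `k > j` that is not saturated gives a step `≥ 3`.
  refine ih k hkn (fun m hm => hF m (by omega)) ?_ hend
  by_contra hns
  have := shift_succ_of_not_saturated hns
  have := hS.monotone (show j + 1 ≤ k by omega)
  omega

theorem endsFamily_succ_iff (hp : 5 ≤ p) {n : ℕ} (hF : ∀ m ≤ n, 1 ≤ m → LastSonFormula p hp m)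
    (hs : ¬ Saturated p (revCode p n))
    (hw : (rightmost p hp).stat (n + 1) = .white) :
    EndsFamily p hp (n + 1) ↔ EndsFamily p hp n := by
  rw [stat_rightmost_eq_white_iff hp (by omega)] at hw
  rw [EndsFamily, EndsFamily, or_iff_left fun ⟨k, hk⟩ => hw (k + 1) hk, or_iff_right hs,
    saturated_revCode_iff (by omega)]
  rw [saturated_revCode_iff (by omega)] at hs
  refine exists_congr fun k => ?_
  have hS := shift_add_le_shift_succ (p := p) k
  have hSk := (strictMono_shift (p := p) (by omega)).le_apply (x := k)
  have hFk := (rightmost p hp).lastSon_add_le_lastSon_succ k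
  have hFk' := ((rightmost p hp).strictMono_lastSon (by omega)).le_apply (x := k)
  have hSn : shift p (k + 1) ≠ n := fun h => hs ⟨k, h⟩
  have hFn := hw (k + 1)
  constructor <;> intro h <;> rcases hF (k + 1) (by omega) (by omega) with h' | h' <;> omega

theorem not_endsFamily_of_black_succ (hp : 5 ≤ p) {n : ℕ}
    (hF : ∀ m ≤ n, 1 ≤ m → LastSonFormula p hp m) (hn : 1 ≤ n)
    (hb : (rightmost p hp).stat (n + 1) = .black) : ¬ EndsFamily p hp n := by
  obtain ⟨k, hk⟩ := (stat_rightmost_eq_black_iff_exists_succ hp (by omega)).1 hb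
  rintro (hs | ⟨i, hi⟩)
  · exact not_endsFamily_succ_of_saturated hp hF hs (.inr ⟨k, hk⟩)
  · have := (rightmost p hp).lastSon_add_le_lastSon (by omega)
      (((rightmost p hp).strictMono_lastSon (by omega)).lt_iff_lt.1
        (show (rightmost p hp).lastSon (i + 1) < (rightmost p hp).lastSon (k + 1) by omega))
    omega

theorem lastSonFormula_succ (hp : 5 ≤ p) {n : ℕ} (hn : 1 ≤ n)
    (hF : ∀ m ≤ n, 1 ≤ m → LastSonFormula p hp m) : LastSonFormula p hp (n + 1) := by
  have hformula := hF n le_rfl hn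
  cases hstat : (rightmost p hp).stat (n + 1) with
  | black =>
    have hend := not_endsFamily_of_black_succ hp hF hn hstat
    have hlast := hformula.of_not_endsFamily hend
    have hlast' := (rightmost p hp).lastSon_succ_of_black hstat
    have hshift := shift_succ_of_not_saturated fun hs => hend (.inl hs)
    exact .inl ⟨.inr ((stat_rightmost_eq_black_iff_exists_succ hp (by omega)).1 hstat), by omega⟩
  | white =>
    have hlast := (rightmost p hp).lastSon_succ_of_white hstat
    by_cases hs : Saturated p (revCode p n)
    · have hlast' := hformula.of_endsFamily (.inl hs)
      have hshift := shift_succ_of_saturated hs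
      exact .inr ⟨not_endsFamily_succ_of_saturated hp hF hs, by omega⟩
    · rw [LastSonFormula, endsFamily_succ_iff hp hF hs hstat, hlast,
        shift_succ_of_not_saturated hs]
      rcases hformula with ⟨hend, hlast'⟩ | ⟨hend, hlast'⟩
      · exact .inl ⟨hend, by omega⟩
      · exact .inr ⟨hend, by omega⟩

theorem lastSonFormula (hp : 5 ≤ p) {n : ℕ} (hn : 1 ≤ n) : LastSonFormula p hp n := by
  induction n using Nat.strong_induction_on with
  | _ n ih =>
  rcases n with _ | _ | n
  · omega
  · exact .inr ⟨not_endsFamily_one hp,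
      ((rightmost p hp).lastSon_one (by omega)).trans shift_one.symm⟩
  · exact lastSonFormula_succ hp (by omega) fun m hm => ih m (by omega)

theorem lastSon_rightmost_of_black_succ (hp : 5 ≤ p) {n : ℕ} (hn : 1 ≤ n)
    (hb : (rightmost p hp).stat (n + 1) = .black) : (rightmost p hp).lastSon n = shift p n :=
  (lastSonFormula hp hn).of_not_endsFamily
    (not_endsFamily_of_black_succ hp (fun _ _ => lastSonFormula hp) hn hb)

theorem shift_succ_of_endsFamily_succ (hp : 5 ≤ p) {n : ℕ} (h : EndsFamily p hp (n + 1)) :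
    shift p (n + 1) = shift p n + (p - 2) :=
  shift_succ_of_not_saturated fun hs =>
    not_endsFamily_succ_of_saturated hp (fun _ _ => lastSonFormula hp) hs h

theorem exists_lastSon_rightmost_iff_nzmSignature_succ (hp : 5 ≤ p) {n : ℕ}
    (hs : ¬ Saturated p (revCode p n)) (hw : (rightmost p hp).stat (n + 1) = .white) :
    (∃ k, (rightmost p hp).lastSon (k + 1) = n) ↔ nzmSignature p (n + 1) = p - 2 := by
  rw [stat_rightmost_eq_white_iff hp (by omega)] at hw
  constructor
  · rintro ⟨k, rfl⟩
    rcases lastSonFormula hp (Nat.le_add_left 1 k) with ⟨hend, hlast⟩ | ⟨-, hlast⟩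
    · have hshift := shift_succ_of_endsFamily_succ hp hend
      rw [nzmSignature_eq_sub (n := k) (by omega) (by omega) (by omega)]
      omega
    · exact absurd ((saturated_revCode_iff (by omega)).2 ⟨k, hlast.symm⟩) hs
  · intro h
    obtain ⟨k, hk, hle⟩ := exists_shift_lt_le_shift_succ (p := p) (m := n + 1) (by omega) (by omega)
    have hstep := shift_succ_le k (p := p)
    rw [nzmSignature_eq_sub (by omega) hk hle] at h
    have hlast := hw (k + 1)
    refine ⟨k, ?_⟩
    rcases lastSonFormula hp (Nat.le_add_left 1 k) with h | h <;> omega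

theorem endsFamily_iff_nzmSignature_succ (hp : 5 ≤ p) {n : ℕ} (hn : 1 ≤ n)
    (hw : (rightmost p hp).stat (n + 1) = .white) :
    EndsFamily p hp n ↔ nzmSignature p (n + 1) = 1 ∨ nzmSignature p (n + 1) = p - 2 := by
  rw [EndsFamily, nzmSignature_succ_eq_one_iff (by omega) hn]
  by_cases hs : Saturated p (revCode p n)
  · exact iff_of_true (.inl hs) (.inl hs)
  · rw [exists_lastSon_rightmost_iff_nzmSignature_succ hp hs hw]

/-! ### The sons in the rightmost tree -/

theorem Assignment.kind_one (α : Assignment p) : α.kind 1 = .r := by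
  simp [Assignment.kind]

theorem Assignment.kind_of_black (α : Assignment p) {ν : ℕ} (hν : 1 < ν)
    (h : α.stat ν = .black) : α.kind ν = .b := by
  rw [Assignment.kind, if_neg hν.ne', h]

theorem Assignment.kind_of_white (α : Assignment p) {ν : ℕ} (hν : 1 < ν)
    (h : α.stat ν = .white) : α.kind ν = .w := by
  rw [Assignment.kind, if_neg hν.ne', h]

theorem nzmCode_son_of_white (hp : 5 ≤ p) {n h : ℕ} (hn : 1 ≤ n)
    (hw : (rightmost p hp).stat (n + 1) = .white) (h1 : 1 ≤ h) (hle : h ≤ p - 2) :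
    nzmCode p ((rightmost p hp).lastSon n + h) =
      table p .w (nzmSignature p (n + 1)) (nzmCode p n) (nzmCode p (n - 1)) h := by
  obtain ⟨n, rfl⟩ := Nat.exists_eq_add_of_le' hn
  have hiff := endsFamily_iff_nzmSignature_succ hp hn hw
  rw [table, Nat.add_sub_cancel]
  by_cases hend : EndsFamily p hp (n + 1)
  · have hlast := (lastSonFormula hp hn).of_endsFamily hend
    have hgap := shift_succ_of_endsFamily_succ hp hend
    have hgap' := shift_add_le_shift_succ (p := p) (n + 1)
    rw [if_pos (hiff.1 hend)]
    split_ifs <;> exact (nzmCode_eq_append_iff (by omega)).2 (by omega)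
  · have hlast := (lastSonFormula hp hn).of_not_endsFamily hend
    have hgap := shift_succ_of_not_saturated fun hs => hend (.inl hs)
    rw [if_neg (mt hiff.2 hend)]
    split_ifs <;> exact (nzmCode_eq_append_iff (by omega)).2 (by omega)

theorem nzmCode_son (hp : 5 ≤ p) {n h : ℕ} (h1 : 1 ≤ h)
    (hle : h ≤ sonCount p ((rightmost p hp).stat (n + 1))) :
    nzmCode p ((rightmost p hp).lastSon n + h) =
      table p ((rightmost p hp).kind (n + 1)) (nzmSignature p (n + 1)) (nzmCode p n)
        (nzmCode p (n - 1)) h := by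
  rcases Nat.eq_zero_or_pos n with rfl | hn
  · rw [(rightmost p hp).stat_root, sonCount_black] at hle
    rw [zero_add, Assignment.kind_one, table, Assignment.lastSon_zero,
      nzmCode_eq_append (p := p) (n := 0) (by omega) (by rw [shift]; omega)
        (by rw [zero_add, shift_one]; omega), nzmCode_zero (by omega), shift]
    split_ifs
    · simp [add_comm]
    · simp only [List.nil_append, List.cons.injEq, and_true]
      omega
  cases hstat : (rightmost p hp).stat (n + 1) with
  | black =>
    rw [hstat, sonCount_black] at hle
    have hgap := shift_add_le_shift_succ (p := p) n
    rw [Assignment.kind_of_black _ (by omega) hstat, table,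
      lastSon_rightmost_of_black_succ hp hn hstat]
    exact (nzmCode_eq_append_iff (by omega)).2 (by omega)
  | white =>
    rw [hstat, sonCount_white] at hle
    rw [Assignment.kind_of_white _ (by omega) hstat]
    exact nzmCode_son_of_white hp hn hstat h1 hle

theorem map_sons_eq_append (hp : 5 ≤ p) (n : ℕ) :
    ((rightmost p hp).sons (n + 1)).map
        (fun σ => ((rightmost p hp).stat σ, nzmSignature p σ)) =
      (List.range' ((rightmost p hp).lastSon n + 1)
          (sonCount p ((rightmost p hp).stat (n + 1)) - 1)).map
        (fun σ => (.white, nzmSignature p σ)) ++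
      [(.black, nzmSignature p ((rightmost p hp).lastSon (n + 1)))] := by
  have hmono := (rightmost p hp).strictMono_lastSon (by omega)
  have hcount := sonCount_pos hp ((rightmost p hp).stat (n + 1))
  have hlast := (rightmost p hp).lastSon_succ n
  rw [Assignment.sons_eq_range',
    ← Nat.sub_add_cancel (show 1 ≤ sonCount p ((rightmost p hp).stat (n + 1)) by omega),
    List.range'_1_concat, List.map_append, List.map_singleton, Nat.add_sub_cancel]
  rw [show (rightmost p hp).lastSon n + 1 + (sonCount p ((rightmost p hp).stat (n + 1)) - 1) =
    (rightmost p hp).lastSon (n + 1) by omega,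
    (stat_rightmost_eq_black_iff hp (by omega)).2 ⟨n + 1, rfl⟩]
  congr 1
  refine List.map_congr_left fun σ hσ => ?_
  rw [List.mem_range'_1] at hσ
  have hwhite : (rightmost p hp).stat σ = .white := by
    rw [stat_rightmost_eq_white_iff hp (by omega)]
    rintro k rfl
    have hnk : n < k := hmono.lt_iff_lt.1 hσ.1
    have hkn := hmono.monotone (show n + 1 ≤ k from hnk)
    omega
  rw [hwhite]

theorem map_range'_eq_whites (hp : 4 ≤ p) {n i j : ℕ} (hi : 1 ≤ i)
    (hj : shift p n + j ≤ shift p (n + 1)) :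
    (List.range' (shift p n + i) (j + 1 - i)).map (fun σ => (Status.white, nzmSignature p σ)) =
      whites i j := by
  rw [whites, ← List.map_add_range', List.map_map]
  refine List.map_congr_left fun a ha => ?_
  rw [List.mem_range'_1] at ha
  rw [Function.comp_apply, nzmSignature_eq_sub hp (n := n) (by omega) (by omega),
    Nat.add_sub_cancel_left]

theorem map_sons_eq_whites_append (hp : 5 ≤ p) {n k i j : ℕ} (hi : 1 ≤ i)
    (hfirst : (rightmost p hp).lastSon n + 1 = shift p k + i)
    (hlast : (rightmost p hp).lastSon (n + 1) = shift p k + (j + 1))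
    (hj : shift p k + (j + 1) ≤ shift p (k + 1)) :
    ((rightmost p hp).sons (n + 1)).map
        (fun σ => ((rightmost p hp).stat σ, nzmSignature p σ)) =
      whites i j ++ [(.black, j + 1)] := by
  have hcount := (rightmost p hp).lastSon_succ n
  rw [map_sons_eq_append, hfirst, hlast, nzmSignature_eq_sub (by omega) (by omega) hj,
    Nat.add_sub_cancel_left,
    show sonCount p ((rightmost p hp).stat (n + 1)) - 1 = j + 1 - i by omega,
    map_range'_eq_whites (by omega) hi (by omega)]

theorem map_sons_of_white (hp : 5 ≤ p) {n : ℕ} (hn : 1 ≤ n)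
    (hw : (rightmost p hp).stat (n + 1) = .white) :
    ((rightmost p hp).sons (n + 1)).map
        (fun σ => ((rightmost p hp).stat σ, nzmSignature p σ)) =
      rules p .w (nzmSignature p (n + 1)) := by
  obtain ⟨n, rfl⟩ := Nat.exists_eq_add_of_le' hn
  have hiff := endsFamily_iff_nzmSignature_succ hp hn hw
  have hlast' := (rightmost p hp).lastSon_succ_of_white hw
  rw [rules]
  by_cases hend : EndsFamily p hp (n + 1)
  · have hlast := (lastSonFormula hp hn).of_endsFamily hend
    have hgap := shift_succ_of_endsFamily_succ hp hend
    have hgap' := shift_add_le_shift_succ (p := p) (n + 1)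
    rw [if_pos (hiff.1 hend), map_sons_eq_append, hw, sonCount_white, hlast,
      show p - 2 - 1 = p - 4 + 1 - 1 + 1 by omega, List.range'_succ, List.map_cons,
      map_range'_eq_whites (by omega) le_rfl (by omega),
      nzmSignature_eq_sub (n := n) (by omega) (by omega) le_rfl,
      nzmSignature_eq_sub (n := n + 1) (by omega) (by omega) (by omega), hgap,
      Nat.add_sub_cancel_left,
      show (rightmost p hp).lastSon (n + 1 + 1) - (shift p n + (p - 2)) = p - 3 by omega]
  · have hlast := (lastSonFormula hp hn).of_not_endsFamily hend
    have hgap := shift_succ_of_not_saturated fun hs => hend (.inl hs)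
    rw [if_neg (mt hiff.2 hend), map_sons_eq_whites_append hp (k := n + 1) (i := 1) (j := p - 3)
      le_rfl (by omega) (by omega) (by omega), show p - 3 + 1 = p - 2 by omega]

theorem map_sons_rightmost (hp : 5 ≤ p) (n : ℕ) :
    ((rightmost p hp).sons (n + 1)).map
        (fun σ => ((rightmost p hp).stat σ, nzmSignature p σ)) =
      rules p ((rightmost p hp).kind (n + 1)) (nzmSignature p (n + 1)) := by
  rcases Nat.eq_zero_or_pos n with rfl | hn
  · have hzero := (rightmost p hp).lastSon_zero
    have hone := (rightmost p hp).lastSon_one (by omega)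
    have hshift := shift_one (p := p)
    rw [zero_add, Assignment.kind_one, rules, ← zero_add 1,
      map_sons_eq_whites_append hp (k := 0) (i := 2) (j := p - 3) (by omega)
        (by rw [shift]; omega) (by rw [zero_add, hone, shift]; omega)
        (by rw [zero_add, hshift, shift]; omega),
      show p - 3 + 1 = p - 2 by omega]
  cases hstat : (rightmost p hp).stat (n + 1) with
  | black =>
    have hlast := lastSon_rightmost_of_black_succ hp hn hstat
    have hlast' := (rightmost p hp).lastSon_succ_of_black hstat
    have hgap := shift_add_le_shift_succ (p := p) n
    rw [Assignment.kind_of_black _ (by omega) hstat, rules,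
      map_sons_eq_whites_append hp (k := n) (i := 1) (j := p - 4) le_rfl (by omega) (by omega)
        (by omega), show p - 4 + 1 = p - 3 by omega]
  | white =>
    rw [Assignment.kind_of_white _ (by omega) hstat]
    exact map_sons_of_white hp hn hstat

theorem shift_add_one_eq_first_or_second_son (hp : 5 ≤ p) {n : ℕ} (hn : 1 ≤ n) :
    ((rightmost p hp).sons (n + 1))[0]? = some (shift p n + 1) ∨
      ((rightmost p hp).sons (n + 1))[1]? = some (shift p n + 1) := by
  have hcount := sonCount_pos hp ((rightmost p hp).stat (n + 1))
  rw [Assignment.getElem?_sons _ (h := 1) le_rfl (by omega),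
    Assignment.getElem?_sons _ (h := 2) (by omega) hcount, Option.some_inj, Option.some_inj]
  rcases lastSonFormula hp hn with h | h <;> omega

end MetallicTree

theorem mainTheorem4 (p : ℕ) (hp : 5 ≤ p) :
    -- every positive integer has exactly one nzm-code, so that `nzmCode` is that code
    (∀ n, 1 ≤ n → ∃! w, MetallicTree.IsNzmCode p n w) ∧
    -- the statuses and the signatures of the sons are given by the rules
    (∀ ν, 1 ≤ ν →
      ((MetallicTree.rightmost p hp).sons ν).map
          (fun σ => ((MetallicTree.rightmost p hp).stat σ, MetallicTree.nzmSignature p σ)) =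
        MetallicTree.rules p ((MetallicTree.rightmost p hp).kind ν)
          (MetallicTree.nzmSignature p ν)) ∧
    -- the codes of the sons are given by the table
    (∀ ν, 1 ≤ ν → ∀ h, 1 ≤ h → h ≤ ((MetallicTree.rightmost p hp).sons ν).length →
      ∃ σ, ((MetallicTree.rightmost p hp).sons ν)[h - 1]? = some σ ∧
        MetallicTree.nzmCode p σ =
          MetallicTree.table p ((MetallicTree.rightmost p hp).kind ν)
            (MetallicTree.nzmSignature p ν)
            (MetallicTree.nzmCode p (ν - 1)) (MetallicTree.nzmCode p (ν - 2)) h) ∧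
    -- the successor of `ν` is the first or the second son of `ν + 1`
    (∀ ν, 1 ≤ ν → ∃ σ, (∀ n, MetallicTree.IsSuccessor p ν n ↔ n = σ) ∧
      (((MetallicTree.rightmost p hp).sons (ν + 1))[0]? = some σ ∨
        ((MetallicTree.rightmost p hp).sons (ν + 1))[1]? = some σ)) ∧
    -- no preferred son property under the rightmost assignment
    (∀ a, 1 ≤ a → a ≤ p - 2 → ¬ (MetallicTree.rightmost p hp).HasPreferredSons a) ∧
    -- no preferred son property, and even no preferred son of any node, under any assignment
    (∀ α : MetallicTree.Assignment p, ∀ a, 1 ≤ a → a ≤ p - 2 →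
      ¬ α.HasPreferredSons a ∧
        ∀ ν, 1 ≤ ν → ∀ σ ∈ α.sons ν, MetallicTree.nzmCode p σ ≠ MetallicTree.nzmCode p ν ++ [a]) := by
  open MetallicTree in
  refine ⟨fun n _ => existsUnique_isNzmCode (by omega) n, fun ν hν => ?_, fun ν hν h h1 hle => ?_,
    fun ν hν => ⟨_, fun _ => isSuccessor_iff (by omega),
      shift_add_one_eq_first_or_second_son hp hν⟩,
    fun a _ _ => not_hasPreferredSons (by omega) _ a,
    fun α a _ _ => ⟨not_hasPreferredSons (by omega) α a,
      fun ν hν σ hσ => nzmCode_ne_of_mem_sons (by omega) α hν a hσ⟩⟩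
  · obtain ⟨n, rfl⟩ := Nat.exists_eq_add_of_le' hν
    exact map_sons_rightmost hp n
  · obtain ⟨n, rfl⟩ := Nat.exists_eq_add_of_le' hν
    rw [Assignment.sons_eq_range', List.length_range'] at hle
    exact ⟨_, Assignment.getElem?_sons _ h1 hle, nzmCode_son hp h1 hle⟩
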